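/- Let $F$ be a field of characteristic zero and let $A$ be a finite-dimensional (left) Leibniz algebra over $F$, i.e. a finite-dimensional $F$-vector space with a bilinear multiplication such that $x(yz)=(xy)z+y(xz)$ for all $x,y,z\in A$. For subspaces $B,C\subseteq A$ let $BC$ denote the linear span of all products $bc$ with $b\in B$, $c\in C$. A subalgebra $B$ is called solvable if $B^{(m)}=\{0\}$ for some $m\ge 1$, where $B^{(1)}=B$ and $B^{(i)}=B^{(i-1)}B^{(i-1)}$, and nilpotent if $B^{m}=\{0\}$ for some $m\ge 1$, where $B^1=B$ and $B^i=B\,B^{i-1}$. Then $A$ has a largest solvable (two-sided) ideal $R=\mathrm{rad}(A)$ and a largest nilpotent (two-sided) ideal $N=\mathrm{nilrad}(A)$, and the following hold. 1. $AR+RA\subseteq N$. 2. If $A$ is solvable, then $A^2=AA$ is nilpotent. 3. $\mathrm{nilrad}(\mathrm{rad}(A))=\mathrm{nilrad}(A)$; that is, the largest nilpotent ideal of the Leibniz algebra $R$ is $N$. -/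

import Mathlib

/-- A (left) Leibniz algebra: every left multiplication `L_x : y ↦ x * y` is a derivation.
The underlying bilinear multiplication is carried by `NonUnitalNonAssocRing A`, `Module F A`,
`IsScalarTower F A A` and `SMulCommClass F A A`. -/
class IsLeftLeibniz (A : Type*) [NonUnitalNonAssocRing A] : Prop where
  leibniz : ∀ x y z : A, x * (y * z) = (x * y) * z + y * (x * z)

namespace LeibnizAlg

section

variable (F : Type*) [Field F] {A : Type*} [NonUnitalNonAssocRing A] [Module F A]
  [IsScalarTower F A A] [SMulCommClass F A A]

variable {F}

/-- The product `B C` of two subspaces: the linear span of all `b * c`, `b ∈ B`, `c ∈ C`. -/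
def prod (B C : Submodule F A) : Submodule F A :=
  Submodule.span F {z : A | ∃ b ∈ B, ∃ c ∈ C, b * c = z}

/-- The derived series, with the index shifted by one: `derivedSeries B n` is `B^{(n+1)}`, where
`B^{(1)} = B` and `B^{(i)} = B^{(i-1)} B^{(i-1)}`. -/
def derivedSeries (B : Submodule F A) : ℕ → Submodule F A
  | 0 => B
  | n + 1 => prod (derivedSeries B n) (derivedSeries B n)

/-- The lower central series, with the index shifted by one: `lowerCentralSeries B n` is
`B^{n+1}`, where `B^1 = B` and `B^i = B B^{i-1}`. -/
def lowerCentralSeries (B : Submodule F A) : ℕ → Submodule F A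
  | 0 => B
  | n + 1 => prod B (lowerCentralSeries B n)

/-- Solvability of a subalgebra `B` (used for ideals, and for `B = ⊤`, the whole algebra). -/
def Solvable (B : Submodule F A) : Prop := ∃ n : ℕ, derivedSeries B n = ⊥

/-- Nilpotency of a subalgebra `B` (used for ideals, and for `B = ⊤`, the whole algebra). -/
def Nilpotent (B : Submodule F A) : Prop := ∃ n : ℕ, lowerCentralSeries B n = ⊥

/-- Two-sided ideals. -/
def IsIdeal (I : Submodule F A) : Prop := ∀ a : A, ∀ x ∈ I, a * x ∈ I ∧ x * a ∈ I

/-- A sum of ideals is an ideal. -/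
theorem isIdeal_sSup (S : Set (Submodule F A)) (hS : ∀ I ∈ S, IsIdeal I) : IsIdeal (sSup S) := by
  intro a x hx
  have h1 : sSup S ≤ (sSup S).comap (LinearMap.mulLeft F a) :=
    sSup_le fun I hI y hy => le_sSup hI (hS I hI a y hy).1
  have h2 : sSup S ≤ (sSup S).comap (LinearMap.mulRight F a) :=
    sSup_le fun I hI y hy => le_sSup hI (hS I hI a y hy).2
  exact ⟨h1 hx, h2 hx⟩

variable (F A)

/-- The radical `rad(A)`: the sum of all solvable ideals of `A`, which, for a finite-dimensional
Leibniz algebra, is the largest solvable ideal. -/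
def rad : Submodule F A := sSup {I : Submodule F A | IsIdeal I ∧ Solvable I}

/-- The nilradical `nilrad(A)`: the sum of all nilpotent ideals of `A`, which, for a
finite-dimensional Leibniz algebra, is the largest nilpotent ideal. -/
def nilrad : Submodule F A := sSup {I : Submodule F A | IsIdeal I ∧ Nilpotent I}

/-- The radical as a subalgebra of `A`, hence as an algebra in its own right. -/
def radSubalgebra : NonUnitalSubalgebra F A :=
  { rad F A with
    mul_mem' := fun {a b} _ hb =>
      (isIdeal_sSup {I : Submodule F A | IsIdeal I ∧ Solvable I} (fun _ hI => hI.1) a b hb).1 }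

end

end LeibnizAlg

/-! The Leibniz identity says that left multiplications satisfy `L_{xy} = [L_x, L_y]`
(`mulLeft_mul_eq_lie`), so they form a Lie algebra `L` acting on `A`, and a solvable ideal `I` of
`A` gives a solvable ideal of `L`. In characteristic zero the bracket of `L` with a solvable ideal
acts nilpotently on every finite-dimensional module (`isNilpotent_top_lie`). Since `AI + IA` maps
into this bracket and powers `B^i = B B^{i-1}` only involve left multiplications, `AI + IA` is
nilpotent: this gives 1, and 2 with `I = A`. For 3, `nilrad(R)` lies in `R` and contains `N`, hence
`AR + RA`, so it is an ideal of `A`.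

The Lie statement needs no eigenvectors, hence no algebraic closure: traces `tr([x, a] y)` vanish
when `a` and `y` commute, which forces nilpotency, and irreducibility turns nilpotency into
vanishing. -/

theorem Module.End.commute_aeval_left {F V : Type*} [Field F] [AddCommGroup V] [Module F V]
    (p : Polynomial F) {c y : Module.End F V} (h : Commute c y) :
    Commute (Polynomial.aeval c p) y := by
  induction p using Polynomial.induction_on' with
  | add p q hp hq => rw [map_add]; exact hp.add_left hq
  | monomial n t =>
    rw [Polynomial.aeval_monomial]
    exact Commute.mul_left (Algebra.commutes t y) (h.pow_left n)

/-! ### A trace criterion for nilpotency -/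

open Polynomial in
/-- In characteristic zero, an endomorphism `c` of a finite-dimensional space is nilpotent as soon
as `c * p(c)` is traceless for every polynomial `p`. -/
theorem Module.End.isNilpotent_of_trace_mul_aeval_eq_zero {F V : Type*} [Field F] [CharZero F]
    [AddCommGroup V] [Module F V] [FiniteDimensional F V] (c : Module.End F V)
    (h : ∀ p : F[X], LinearMap.trace F V (c * aeval c p) = 0) : IsNilpotent c := by
  obtain ⟨n, q, hq, hmin⟩ := WfDvdMonoid.max_power_factor
    (minpoly.ne_zero (Algebra.IsIntegral.isIntegral (R := F) c)) (irreducible_X (R := F))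
  have hcop : IsCoprime (X ^ (n + 1) : F[X]) q :=
    ((irreducible_X (R := F)).coprime_iff_not_dvd.mpr hq).pow_left
  obtain ⟨u, v, huv⟩ := hcop
  have hzero : aeval c (X ^ n * q) = 0 := hmin ▸ minpoly.aeval F c
  have key : ∀ p : F[X], aeval c (X ^ n * q * p) = 0 := fun p => by
    rw [map_mul, hzero, zero_mul]
  -- This is the Fitting projection onto the part where `c` is invertible. The exponent `n + 1`
  -- provides a factor `c` even if `n = 0`, so its trace vanishes by hypothesis.
  have hid : IsIdempotentElem (aeval c (u * X ^ (n + 1))) := by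
    have : u * X ^ (n + 1) * (u * X ^ (n + 1)) =
        u * X ^ (n + 1) - X ^ n * q * (u * v * X) := by
      linear_combination (u * X ^ (n + 1)) * huv
    rw [IsIdempotentElem, ← map_mul, this, map_sub, key, sub_zero]
  have htr : LinearMap.trace F V (aeval c (u * X ^ (n + 1))) = 0 := by
    have := h (u * X ^ n)
    rwa [show c * aeval c (u * X ^ n) = aeval c (u * X ^ (n + 1)) by
      rw [show u * X ^ (n + 1) = X * (u * X ^ n) by ring, map_mul (aeval c) X, aeval_X]] at this
  have h0 := LinearMap.IsIdempotentElem.eq_zero_of_trace_eq_zero hid htr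
  refine ⟨n, ?_⟩
  have : (X ^ n : F[X]) = X ^ n * (u * X ^ (n + 1)) + X ^ n * q * v := by
    linear_combination -(X ^ n : F[X]) * huv
  rw [← aeval_X_pow (R := F), this, map_add, key, map_mul, h0, mul_zero, add_zero]

/-! ### Solvable ideals acting on finite-dimensional Lie modules -/

namespace LieModule

attribute [local instance] LieRing.ofAssociativeRing

section

variable {F L V : Type*} [Field F] [LieRing L] [LieAlgebra F L]
  [AddCommGroup V] [Module F V] [LieRingModule L V] [LieModule F L V]

/-- By cyclicity of the trace, `tr([x, a] y) = tr(x [a, y])`. -/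
theorem trace_toEnd_lie_mul_eq_zero {x a : L} {y : Module.End F V}
    (h : Commute (toEnd F L V a) y) : LinearMap.trace F V (toEnd F L V ⁅x, a⁆ * y) = 0 := by
  rw [LieHom.map_lie, Ring.lie_def, sub_mul, map_sub, mul_assoc, mul_assoc, h.eq,
    LinearMap.trace_mul_comm F (toEnd F L V a), mul_assoc, sub_self]

theorem trace_toEnd_mul_eq_zero_of_mem_top_lie {I : LieIdeal F L} {c : L}
    (hc : c ∈ ⁅(⊤ : LieIdeal F L), I⁆) {y : Module.End F V}
    (h : ∀ a ∈ I, Commute (toEnd F L V a) y) :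
    LinearMap.trace F V (toEnd F L V c * y) = 0 := by
  rw [← LieSubmodule.mem_toSubmodule, LieSubmodule.lieIdeal_oper_eq_linear_span'] at hc
  induction hc using Submodule.span_induction with
  | mem c hc =>
    obtain ⟨x, -, a, ha, rfl⟩ := hc
    exact trace_toEnd_lie_mul_eq_zero (h a ha)
  | zero => simp
  | add c d _ _ hc hd => rw [map_add, add_mul, map_add, hc, hd, add_zero]
  | smul t c _ hc => rw [map_smul, smul_mul_assoc, map_smul, hc, smul_zero]

/-- The vectors killed by an ideal form a submodule; on an irreducible module an ideal that kills
a nonzero vector acts as zero. -/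
theorem lie_eq_zero_of_exists_ne_zero [IsIrreducible F L V] (I : LieIdeal F L)
    (h : ∃ v : V, v ≠ 0 ∧ ∀ c ∈ I, ⁅c, v⁆ = 0) : ∀ c ∈ I, ∀ v : V, ⁅c, v⁆ = 0 := by
  let K : LieSubmodule F L V :=
    { carrier := {v | ∀ c ∈ I, ⁅c, v⁆ = 0}
      zero_mem' := fun c _ => lie_zero c
      add_mem' := fun {v w} hv hw c hc => by rw [lie_add, hv c hc, hw c hc, add_zero]
      smul_mem' := fun t v hv c hc => by rw [lie_smul, hv c hc, smul_zero]
      lie_mem := fun {x v} hv c hc => by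
        rw [leibniz_lie, hv _ (lie_mem_left F L I c x hc), hv c hc, lie_zero, add_zero] }
  obtain ⟨v, hv, hvI⟩ := h
  have hK : K = ⊤ := (IsSimpleOrder.eq_bot_or_eq_top K).resolve_left fun hK =>
    hv ((LieSubmodule.mem_bot v).mp (hK ▸ (show v ∈ K from hvI)))
  intro c hc w
  exact (hK ▸ LieSubmodule.mem_top w : w ∈ K) c hc

variable [CharZero F] [FiniteDimensional F V]

/-- Each `c` in `[L, I]` lies in `I`, so polynomials in `c` commute with `I` and the trace criterion
makes `c` nilpotent. Engel's theorem yields a common null vector. -/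
theorem lie_eq_zero_of_mem_top_lie_of_commute [IsIrreducible F L V] (I : LieIdeal F L)
    (hI : ∀ a ∈ I, ∀ b ∈ I, Commute (toEnd F L V a) (toEnd F L V b)) :
    ∀ c ∈ ⁅(⊤ : LieIdeal F L), I⁆, ∀ v : V, ⁅c, v⁆ = 0 := by
  have hnil : ∀ c ∈ ⁅(⊤ : LieIdeal F L), I⁆, _root_.IsNilpotent (toEnd F L V c) := fun c hc =>
    Module.End.isNilpotent_of_trace_mul_aeval_eq_zero _ fun p =>
      trace_toEnd_mul_eq_zero_of_mem_top_lie hc fun a ha =>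
        (Module.End.commute_aeval_left p
          (hI c (LieSubmodule.lie_le_right I ⊤ hc) a ha)).symm
  have : IsNilpotent (⁅(⊤ : LieIdeal F L), I⁆ : LieIdeal F L) V :=
    (LieModule.isNilpotent_iff_forall' (R := F)).mpr fun c => hnil c c.2
  have : Nontrivial V := (LieSubmodule.nontrivial_iff F L V).mp inferInstance
  have := nontrivial_max_triv_of_isNilpotent F (⁅(⊤ : LieIdeal F L), I⁆ : LieIdeal F L) V
  obtain ⟨v, hv⟩ := exists_ne
    (0 : maxTrivSubmodule F (⁅(⊤ : LieIdeal F L), I⁆ : LieIdeal F L) V)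
  exact lie_eq_zero_of_exists_ne_zero _ ⟨v, fun h => hv (Subtype.ext h), fun c hc => v.2 ⟨c, hc⟩⟩

/-- An element of `[L, I]` which acts centrally on an irreducible module acts as zero. -/
theorem toEnd_eq_zero_of_mem_top_lie_of_commute [IsIrreducible F L V] (I : LieIdeal F L)
    {b : L} (hb : b ∈ ⁅(⊤ : LieIdeal F L), I⁆)
    (h : ∀ x : L, Commute (toEnd F L V x) (toEnd F L V b)) : toEnd F L V b = 0 := by
  have hnil : _root_.IsNilpotent (toEnd F L V b) :=
    Module.End.isNilpotent_of_trace_mul_aeval_eq_zero _ fun p =>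
      trace_toEnd_mul_eq_zero_of_mem_top_lie hb fun a _ =>
        (Module.End.commute_aeval_left p (h a).symm).symm
  let K : LieSubmodule F L V :=
    { LinearMap.ker (toEnd F L V b) with
      lie_mem := fun {x v} hv => by
        have := LinearMap.congr_fun (h x).eq v
        simp only [Module.End.mul_apply, toEnd_apply_apply] at this
        change ⁅b, v⁆ = 0 at hv
        change ⁅b, ⁅x, v⁆⁆ = 0
        rw [← this, hv, lie_zero] }
  rcases IsSimpleOrder.eq_bot_or_eq_top K with hK | hK
  · have hinj : Function.Injective (toEnd F L V b) := LinearMap.ker_eq_bot.mp <|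
      (Submodule.eq_bot_iff _).mpr fun v hv =>
        (LieSubmodule.mem_bot v).mp (hK ▸ (show v ∈ K from hv))
    obtain ⟨n, hn⟩ := hnil
    ext v
    refine (hinj.iterate n) ?_
    rw [← Module.End.coe_pow, hn]
    rfl
  · ext v
    exact (hK ▸ LieSubmodule.mem_top v : v ∈ K)

/-- If `I` is a solvable ideal of `L`, then `[L, I]` acts as zero on irreducible modules. -/
theorem lie_eq_zero_of_mem_top_lie [IsIrreducible F L V] (I : LieIdeal F L)
    {k : ℕ} (hk : LieAlgebra.derivedSeriesOfIdeal F L k I = ⊥) :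
    ∀ c ∈ ⁅(⊤ : LieIdeal F L), I⁆, ∀ v : V, ⁅c, v⁆ = 0 := by
  set J := ⁅(⊤ : LieIdeal F L), I⁆
  -- Induction up the derived series from its vanishing term. The series of `J`, not of `I`, keeps
  -- every term inside `[L, I]`.
  suffices H : ∀ n ≤ k, ∀ c ∈ LieAlgebra.derivedSeriesOfIdeal F L (k - n) J, ∀ v : V, ⁅c, v⁆ = 0 by
    simpa using H k le_rfl
  intro n
  induction n with
  | zero =>
    intro _ c hc v
    have := LieAlgebra.derivedSeriesOfIdeal_mono (LieSubmodule.lie_le_right I ⊤ : J ≤ I) k hc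
    rw [hk, LieSubmodule.mem_bot] at this
    rw [this, zero_lie]
  | succ n ih =>
    intro hn c hc v
    have ih' := ih (by omega)
    rw [show k - n = k - (n + 1) + 1 by omega, LieAlgebra.derivedSeriesOfIdeal_succ] at ih'
    set D := LieAlgebra.derivedSeriesOfIdeal F L (k - (n + 1)) J
    have comm_of {x y : L} (h : ∀ v : V, ⁅⁅x, y⁆, v⁆ = 0) :
        Commute (toEnd F L V x) (toEnd F L V y) := by
      rw [commute_iff_lie_eq, ← LieHom.map_lie]
      ext v
      exact h v
    -- `[D, D]` acts as zero, so `D` acts commutatively, so `[L, D]` acts as zero, so `D` acts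
    -- centrally.
    have hD := lie_eq_zero_of_mem_top_lie_of_commute (V := V) D fun a ha b hb =>
      comm_of (ih' _ (LieSubmodule.lie_mem_lie ha hb))
    have := toEnd_eq_zero_of_mem_top_lie_of_commute (V := V) I (b := c)
      (LieAlgebra.derivedSeriesOfIdeal_le_self J _ hc) fun x =>
        comm_of (hD _ (LieSubmodule.lie_mem_lie (LieSubmodule.mem_top x) hc))
    exact LinearMap.congr_fun this v

end

variable {F L : Type*} [Field F] [CharZero F] [LieRing L] [LieAlgebra F L]

/-- If `I` is a solvable ideal of `L`, then the elements of `[L, I]` act nilpotently on every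
finite-dimensional module. -/
theorem isNilpotent_toEnd_of_mem_top_lie (I : LieIdeal F L)
    {k : ℕ} (hk : LieAlgebra.derivedSeriesOfIdeal F L k I = ⊥)
    {c : L} (hc : c ∈ ⁅(⊤ : LieIdeal F L), I⁆)
    (V : Type*) [AddCommGroup V] [Module F V] [LieRingModule L V] [LieModule F L V]
    [FiniteDimensional F V] : _root_.IsNilpotent (toEnd F L V c) := by
  induction hd : Module.finrank F V using Nat.strong_induction_on generalizing V with
  | _ d ih =>
  cases subsingleton_or_nontrivial V with
  | inl _ => exact ⟨0, Subsingleton.elim _ _⟩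
  | inr _ =>
  by_cases hirr : ∀ W : LieSubmodule F L V, W ≠ ⊥ → W = ⊤
  · have := IsIrreducible.mk hirr
    refine ⟨1, ?_⟩
    rw [pow_one]
    ext v
    exact lie_eq_zero_of_mem_top_lie I hk c hc v
  -- For a proper nonzero submodule `W`, a power of `c` maps `V` into `W` and another kills `W`.
  · push Not at hirr
    obtain ⟨W, hbot, htop⟩ := hirr
    have hbot' : (W : Submodule F V) ≠ ⊥ := by simpa using hbot
    have htop' : (W : Submodule F V) < ⊤ := lt_top_iff_ne_top.mpr (by simpa using htop)
    have hadd := Submodule.finrank_quotient_add_finrank (W : Submodule F V)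
    have hpos : 0 < Module.finrank F W := Module.finrank_pos_iff.mpr
      (Submodule.nontrivial_iff_ne_bot.mpr hbot')
    obtain ⟨m, hm⟩ := ih _ (hd ▸ Submodule.finrank_lt htop'.ne) W rfl
    obtain ⟨n, hn⟩ := ih (Module.finrank F (V ⧸ W)) (by
      change Module.finrank F (V ⧸ (W : Submodule F V)) < d
      change 0 < Module.finrank F (W : Submodule F V) at hpos
      omega) (V ⧸ W) rfl
    refine ⟨m + n, ?_⟩
    ext v
    have hv : (toEnd F L V c ^ n) v ∈ W := by
      have := LinearMap.congr_fun (Module.End.commute_pow_left_of_commute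
        (LieSubmodule.Quotient.toEnd_comp_mk' W c) n) v
      rw [hn] at this
      exact (Submodule.Quotient.mk_eq_zero _).mp this.symm
    rw [pow_add, Module.End.mul_apply]
    have := LieSubmodule.coe_toEnd_pow F L V W c ⟨_, hv⟩ m
    rw [hm] at this
    exact this.symm

/-- If `I` is a solvable ideal of `L`, then `[L, I]` acts nilpotently on every finite-dimensional
module. -/
theorem isNilpotent_top_lie (I : LieIdeal F L)
    {k : ℕ} (hk : LieAlgebra.derivedSeriesOfIdeal F L k I = ⊥)
    (V : Type*) [AddCommGroup V] [Module F V] [LieRingModule L V] [LieModule F L V]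
    [FiniteDimensional F V] : IsNilpotent (⁅(⊤ : LieIdeal F L), I⁆ : LieIdeal F L) V :=
  (LieModule.isNilpotent_iff_forall' (R := F)).mpr fun c =>
    isNilpotent_toEnd_of_mem_top_lie I hk c.2 V

end LieModule
namespace LeibnizAlg

/-! ### Products, series and powers of ideals -/

section Products

variable {F A : Type*} [Field F] [NonUnitalNonAssocRing A] [Module F A]

theorem mul_mem_prod {B C : Submodule F A} {b c : A} (hb : b ∈ B) (hc : c ∈ C) :
    b * c ∈ prod B C :=
  Submodule.subset_span ⟨b, hb, c, hc, rfl⟩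

theorem prod_le {B C D : Submodule F A} : prod B C ≤ D ↔ ∀ b ∈ B, ∀ c ∈ C, b * c ∈ D := by
  refine ⟨fun h b hb c hc => h (mul_mem_prod hb hc), fun h => Submodule.span_le.mpr ?_⟩
  rintro _ ⟨b, hb, c, hc, rfl⟩
  exact h b hb c hc

theorem prod_mono {B B' C C' : Submodule F A} (hB : B ≤ B') (hC : C ≤ C') :
    prod B C ≤ prod B' C' :=
  prod_le.mpr fun _ hb _ hc => mul_mem_prod (hB hb) (hC hc)

theorem derivedSeries_mono {B C : Submodule F A} (h : B ≤ C) (n : ℕ) :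
    derivedSeries B n ≤ derivedSeries C n := by
  induction n with
  | zero => exact h
  | succ n ih => exact prod_mono ih ih

theorem derivedSeries_add (B : Submodule F A) (m n : ℕ) :
    derivedSeries B (m + n) = derivedSeries (derivedSeries B m) n := by
  induction n with
  | zero => rfl
  | succ n ih => exact congrArg₂ prod ih ih

theorem IsIdeal.prod_top_le {I : Submodule F A} (hI : IsIdeal I) : prod ⊤ I ≤ I :=
  prod_le.mpr fun a _ x hx => (hI a x hx).1

theorem IsIdeal.derivedSeries_le {I : Submodule F A} (hI : IsIdeal I) (n : ℕ) :
    derivedSeries I n ≤ I := by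
  induction n with
  | zero => exact le_rfl
  | succ n ih => exact (prod_mono le_top ih).trans hI.prod_top_le

theorem IsIdeal.derivedSeries_le_lowerCentralSeries {I : Submodule F A} (hI : IsIdeal I) (n : ℕ) :
    derivedSeries I n ≤ lowerCentralSeries I n := by
  induction n with
  | zero => exact le_rfl
  | succ n ih => exact prod_mono (hI.derivedSeries_le n) ih

theorem IsIdeal.solvable_of_nilpotent {I : Submodule F A} (hI : IsIdeal I) (h : Nilpotent I) :
    Solvable I := by
  obtain ⟨n, hn⟩ := h
  exact ⟨n, le_bot_iff.mp ((hI.derivedSeries_le_lowerCentralSeries n).trans hn.le)⟩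

theorem derivedSeries_sup_le {B I : Submodule F A} (hI : IsIdeal I) (n : ℕ) :
    derivedSeries (B ⊔ I) n ≤ derivedSeries B n ⊔ I := by
  induction n with
  | zero => exact le_rfl
  | succ n ih =>
    refine prod_le.mpr fun x hx y hy => ?_
    obtain ⟨b, hb, i, hi, rfl⟩ := Submodule.mem_sup.mp (ih hx)
    obtain ⟨c, hc, j, hj, rfl⟩ := Submodule.mem_sup.mp (ih hy)
    rw [mul_add, add_mul, add_assoc]
    exact Submodule.add_mem_sup (mul_mem_prod hb hc) (I.add_mem (hI c i hi).2 (hI _ j hj).1)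

theorem Solvable.sup {I J : Submodule F A} (hJ : IsIdeal J)
    (h : Solvable I) (h' : Solvable J) : Solvable (I ⊔ J) := by
  obtain ⟨m, hm⟩ := h
  obtain ⟨n, hn⟩ := h'
  refine ⟨m + n, le_bot_iff.mp ?_⟩
  rw [derivedSeries_add, ← hn]
  exact derivedSeries_mono ((derivedSeries_sup_le hJ m).trans (by rw [hm, bot_sup_eq])) n

/-- The powers `I ^ n` of a subspace, `I ^ 0` being the whole algebra and `I ^ n = I I ^ (n - 1)`. -/
def leftPower (I : Submodule F A) : ℕ → Submodule F A
  | 0 => ⊤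
  | n + 1 => prod I (leftPower I n)

theorem lowerCentralSeries_le_leftPower (I : Submodule F A) (n : ℕ) :
    lowerCentralSeries I n ≤ leftPower I n := by
  induction n with
  | zero => exact le_top
  | succ n ih => exact prod_mono le_rfl ih

theorem IsIdeal.leftPower_succ_le {I : Submodule F A} (hI : IsIdeal I) (n : ℕ) :
    leftPower I (n + 1) ≤ lowerCentralSeries I n := by
  induction n with
  | zero => exact prod_le.mpr fun x hx a _ => (hI a x hx).2
  | succ n ih => exact prod_mono le_rfl ih

theorem IsIdeal.nilpotent_iff {I : Submodule F A} (hI : IsIdeal I) :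
    Nilpotent I ↔ ∃ n, leftPower I n = ⊥ :=
  ⟨fun ⟨n, hn⟩ => ⟨n + 1, le_bot_iff.mp ((hI.leftPower_succ_le n).trans hn.le)⟩,
    fun ⟨n, hn⟩ => ⟨n, le_bot_iff.mp ((lowerCentralSeries_le_leftPower I n).trans hn.le)⟩⟩

theorem leftPower_eq_bot_of_le {I : Submodule F A} {m n : ℕ} (hm : leftPower I m = ⊥)
    (h : m ≤ n) : leftPower I n = ⊥ := by
  induction n, h using Nat.le_induction with
  | base => exact hm
  | succ n _ ih =>
    refine le_bot_iff.mp (prod_le.mpr fun x _ y hy => ?_)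
    rw [ih, Submodule.mem_bot] at hy
    rw [hy, mul_zero]
    exact zero_mem _

theorem prod_iSup_le [SMulCommClass F A A] {ι : Sort*} {B D : Submodule F A} {C : ι → Submodule F A}
    (h : ∀ i, prod B (C i) ≤ D) : prod B (⨆ i, C i) ≤ D := by
  refine prod_le.mpr fun b hb c hc => ?_
  have : ⨆ i, C i ≤ D.comap (LinearMap.mulLeft F b) :=
    iSup_le fun i x hx => h i (mul_mem_prod hb hx)
  exact this hc

theorem isIdeal_bot : IsIdeal (⊥ : Submodule F A) := by
  rintro a x hx
  rw [Submodule.mem_bot] at hx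
  simp [hx]

theorem isIdeal_prod_top_sup {I : Submodule F A} (hI : IsIdeal I) :
    IsIdeal (prod ⊤ I ⊔ prod I ⊤) := by
  have hM {a x : A} (hx : x ∈ I) : a * x ∈ prod ⊤ I ⊔ prod I ⊤ :=
    Submodule.mem_sup_left (mul_mem_prod Submodule.mem_top hx)
  have hM' {a x : A} (hx : x ∈ I) : x * a ∈ prod ⊤ I ⊔ prod I ⊤ :=
    Submodule.mem_sup_right (mul_mem_prod hx Submodule.mem_top)
  have hle : prod ⊤ I ⊔ prod I ⊤ ≤ I :=
    sup_le hI.prod_top_le (prod_le.mpr fun x hx a _ => (hI a x hx).2)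
  exact fun a z hz => ⟨hM (hle hz), hM' (hle hz)⟩

theorem map_prod {B : Type*} [NonUnitalNonAssocRing B] [Module F B] (f : B →ₗ[F] A)
    (hf : ∀ x y, f (x * y) = f x * f y) (C D : Submodule F B) :
    (prod C D).map f = prod (C.map f) (D.map f) := by
  apply le_antisymm
  · exact Submodule.map_le_iff_le_comap.mpr <| prod_le.mpr fun x hx y hy => by
      rw [Submodule.mem_comap, hf]
      exact mul_mem_prod (Submodule.mem_map_of_mem hx) (Submodule.mem_map_of_mem hy)
  · refine prod_le.mpr ?_
    rintro _ ⟨x, hx, rfl⟩ _ ⟨y, hy, rfl⟩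
    exact ⟨x * y, mul_mem_prod hx hy, hf x y⟩

theorem map_lowerCentralSeries {B : Type*} [NonUnitalNonAssocRing B] [Module F B] (f : B →ₗ[F] A)
    (hf : ∀ x y, f (x * y) = f x * f y) (C : Submodule F B) (n : ℕ) :
    (lowerCentralSeries C n).map f = lowerCentralSeries (C.map f) n := by
  induction n with
  | zero => rfl
  | succ n ih => exact (map_prod f hf _ _).trans (congrArg _ ih)

theorem nilpotent_map_iff {B : Type*} [NonUnitalNonAssocRing B] [Module F B] {f : B →ₗ[F] A}
    (hf : ∀ x y, f (x * y) = f x * f y) (hinj : Function.Injective f) (C : Submodule F B) :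
    Nilpotent (C.map f) ↔ Nilpotent C :=
  exists_congr fun n => by
    rw [← map_lowerCentralSeries f hf]
    exact (Submodule.map_injective_of_injective hinj).eq_iff' (Submodule.map_bot f)

/-- Left multiplications are derivations preserving `I`, hence preserve its powers. -/
theorem prod_top_leftPower_le [SMulCommClass F A A] [IsLeftLeibniz A]
    {I : Submodule F A} (hI : IsIdeal I) (n : ℕ) :
    prod ⊤ (leftPower I n) ≤ leftPower I n := by
  induction n with
  | zero => exact le_top
  | succ n ih =>
    refine prod_le.mpr fun a _ z hz => ?_
    have : leftPower I (n + 1) ≤ (leftPower I (n + 1)).comap (LinearMap.mulLeft F a) := by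
      refine prod_le.mpr fun x hx y hy => ?_
      change a * (x * y) ∈ leftPower I (n + 1)
      rw [IsLeftLeibniz.leibniz]
      exact add_mem (mul_mem_prod (hI a x hx).1 hy)
        (mul_mem_prod hx (ih (mul_mem_prod Submodule.mem_top hy)))
    exact this hz

/-- In a product with `p` factors from `I` and `q` from `J`, each factor raises one power and,
acting from the left, preserves the other. -/
theorem leftPower_sup_le [SMulCommClass F A A] [IsLeftLeibniz A]
    {I J : Submodule F A} (hI : IsIdeal I) (hJ : IsIdeal J) (n : ℕ) :
    leftPower (I ⊔ J) n ≤ ⨆ p : {p : ℕ × ℕ // p.1 + p.2 = n},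
      leftPower I p.1.1 ⊓ leftPower J p.1.2 := by
  induction n with
  | zero => exact le_iSup_of_le ⟨(0, 0), rfl⟩ (le_inf le_rfl le_rfl)
  | succ n ih =>
    refine (prod_mono le_rfl ih).trans (prod_iSup_le ?_)
    rintro ⟨⟨p, q⟩, rfl⟩
    refine prod_le.mpr fun x hx y hy => ?_
    obtain ⟨i, hi, j, hj, rfl⟩ := Submodule.mem_sup.mp hx
    rw [add_mul]
    refine add_mem ?_ ?_
    · exact Submodule.mem_iSup_of_mem ⟨(p + 1, q), by grind⟩ ⟨mul_mem_prod hi hy.1,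
        prod_top_leftPower_le hJ q (mul_mem_prod Submodule.mem_top hy.2)⟩
    · exact Submodule.mem_iSup_of_mem ⟨(p, q + 1), by grind⟩
        ⟨prod_top_leftPower_le hI p (mul_mem_prod Submodule.mem_top hy.1), mul_mem_prod hj hy.2⟩

end Products

/-! ### Existence of the largest solvable and nilpotent ideals -/

section Radicals

variable {F A : Type*} [Field F] [NonUnitalNonAssocRing A] [Module F A]
  [IsScalarTower F A A] [SMulCommClass F A A]

theorem IsIdeal.sup {I J : Submodule F A} (hI : IsIdeal I) (hJ : IsIdeal J) : IsIdeal (I ⊔ J) := by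
  rw [← sSup_pair]
  refine isIdeal_sSup _ ?_
  rintro K (rfl | rfl)
  exacts [hI, hJ]

/-- A property of ideals that holds for `0` and passes to sums of two ideals holds for the sum of
all ideals with this property. -/
theorem isGreatest_sSup_ideals [FiniteDimensional F A] {P : Submodule F A → Prop}
    (hbot : P ⊥) (hsup : ∀ I J, IsIdeal I → IsIdeal J → P I → P J → P (I ⊔ J)) :
    IsGreatest {I : Submodule F A | IsIdeal I ∧ P I} (sSup {I : Submodule F A | IsIdeal I ∧ P I}) :=
  -- By the ascending chain condition, a nonempty family closed under binary sums contains its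
  -- supremum.
  ⟨(CompleteLattice.isSupClosedCompact_iff_wellFoundedGT _).mpr inferInstance _
      ⟨⊥, isIdeal_bot, hbot⟩ fun I hI J hJ => ⟨hI.1.sup hJ.1, hsup I J hI.1 hJ.1 hI.2 hJ.2⟩,
    fun _ hI => le_sSup hI⟩

variable (F A) in
theorem isGreatest_rad [FiniteDimensional F A] :
    IsGreatest {I : Submodule F A | IsIdeal I ∧ Solvable I} (rad F A) :=
  isGreatest_sSup_ideals ⟨0, rfl⟩ fun _ _ _ hJ h h' => h.sup hJ h'

variable [IsLeftLeibniz A]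

theorem Nilpotent.sup {I J : Submodule F A} (hI : IsIdeal I) (hJ : IsIdeal J)
    (h : Nilpotent I) (h' : Nilpotent J) : Nilpotent (I ⊔ J) := by
  obtain ⟨m, hm⟩ := hI.nilpotent_iff.mp h
  obtain ⟨n, hn⟩ := hJ.nilpotent_iff.mp h'
  refine (hI.sup hJ).nilpotent_iff.mpr ⟨m + n, le_bot_iff.mp ?_⟩
  refine (leftPower_sup_le hI hJ (m + n)).trans (iSup_le ?_)
  rintro ⟨⟨p, q⟩, hpq⟩
  rcases le_or_gt m p with h | h
  · exact inf_le_left.trans (leftPower_eq_bot_of_le hm h).le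
  · exact inf_le_right.trans (leftPower_eq_bot_of_le hn (by grind)).le

variable (F A) in
theorem isGreatest_nilrad [FiniteDimensional F A] :
    IsGreatest {I : Submodule F A | IsIdeal I ∧ Nilpotent I} (nilrad F A) :=
  isGreatest_sSup_ideals ⟨0, rfl⟩ fun _ _ hI hJ h h' => h.sup hI hJ h'

end Radicals

/-! ### The Lie algebra of left multiplications -/

section LeftMultiplications

attribute [local instance] LieRing.ofAssociativeRing

variable {F A : Type*} [Field F] [NonUnitalNonAssocRing A] [Module F A]
  [IsScalarTower F A A] [SMulCommClass F A A] [IsLeftLeibniz A]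

variable (F) in
theorem mulLeft_mul_eq_lie (x y : A) :
    LinearMap.mul F A (x * y) = ⁅LinearMap.mul F A x, LinearMap.mul F A y⁆ := by
  ext z
  rw [Ring.lie_def, LinearMap.sub_apply, Module.End.mul_apply, Module.End.mul_apply]
  simp only [LinearMap.mul_apply']
  rw [IsLeftLeibniz.leibniz x y z, add_sub_cancel_right]

variable (F A) in
/-- The Lie algebra of all left multiplications of a Leibniz algebra. -/
def leftMultiplications : LieSubalgebra F (Module.End F A) :=
  { LinearMap.range (LinearMap.mul F A) with
    lie_mem' := by
      rintro _ _ ⟨x, rfl⟩ ⟨y, rfl⟩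
      exact ⟨x * y, mulLeft_mul_eq_lie F x y⟩ }

variable (F) in
/-- The left multiplication by `x`. -/
def leftMultiplication (x : A) : leftMultiplications F A := ⟨LinearMap.mul F A x, x, rfl⟩

theorem leftMultiplication_mul (x y : A) :
    leftMultiplication F (x * y) = ⁅leftMultiplication F x, leftMultiplication F y⁆ :=
  Subtype.ext (mulLeft_mul_eq_lie F x y)

theorem leftMultiplication_lie (x y : A) : ⁅leftMultiplication F x, y⁆ = x * y := rfl

/-- The left multiplications by the elements of an ideal. -/
def leftMultiplicationsOfIdeal {I : Submodule F A} (hI : IsIdeal I) :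
    LieIdeal F (leftMultiplications F A) :=
  { (I.map (LinearMap.mul F A)).comap (leftMultiplications F A).toSubmodule.subtype with
    lie_mem := by
      rintro ⟨_, a, rfl⟩ ⟨_, h⟩ ⟨x, hx, rfl⟩
      exact ⟨a * x, (hI a x hx).1, mulLeft_mul_eq_lie F a x⟩ }

theorem leftMultiplication_mem {I : Submodule F A} (hI : IsIdeal I) {x : A} (hx : x ∈ I) :
    leftMultiplication F x ∈ leftMultiplicationsOfIdeal hI :=
  ⟨x, hx, rfl⟩

theorem exists_eq_leftMultiplication {I : Submodule F A} (hI : IsIdeal I)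
    {c : leftMultiplications F A} (hc : c ∈ leftMultiplicationsOfIdeal hI) :
    ∃ x ∈ I, c = leftMultiplication F x := by
  obtain ⟨x, hx, h⟩ := hc
  exact ⟨x, hx, Subtype.ext h.symm⟩

theorem isIdeal_derivedSeries {I : Submodule F A} (hI : IsIdeal I) (n : ℕ) :
    IsIdeal (derivedSeries I n) := by
  induction n with
  | zero => exact hI
  | succ n ih =>
    refine fun a z hz => ⟨?_, ?_⟩
    · have : derivedSeries I (n + 1) ≤
          (derivedSeries I (n + 1)).comap (LinearMap.mulLeft F a) := by
        refine prod_le.mpr fun x hx y hy => ?_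
        change a * (x * y) ∈ derivedSeries I (n + 1)
        rw [IsLeftLeibniz.leibniz]
        exact add_mem (mul_mem_prod (ih a x hx).1 hy) (mul_mem_prod hx (ih a y hy).1)
      exact this hz
    · have : derivedSeries I (n + 1) ≤
          (derivedSeries I (n + 1)).comap (LinearMap.mulRight F a) := by
        refine prod_le.mpr fun x hx y hy => ?_
        change x * y * a ∈ derivedSeries I (n + 1)
        -- The Leibniz identity rewrites `(xy)a` as `x(ya) - y(xa)`.
        rw [eq_sub_of_add_eq (IsLeftLeibniz.leibniz x y a).symm]
        exact sub_mem (mul_mem_prod hx (ih a y hy).2) (mul_mem_prod hy (ih a x hx).2)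
      exact this hz

theorem derivedSeriesOfIdeal_leftMultiplicationsOfIdeal_le {I : Submodule F A} (hI : IsIdeal I)
    (n : ℕ) : LieAlgebra.derivedSeriesOfIdeal F _ n (leftMultiplicationsOfIdeal hI) ≤
      leftMultiplicationsOfIdeal (isIdeal_derivedSeries hI n) := by
  induction n with
  | zero => exact le_rfl
  | succ n ih =>
    rw [LieAlgebra.derivedSeriesOfIdeal_succ, LieSubmodule.lieIdeal_oper_eq_span,
      LieSubmodule.lieSpan_le]
    rintro _ ⟨⟨c, hc⟩, ⟨d, hd⟩, rfl⟩
    obtain ⟨x, hx, rfl⟩ := exists_eq_leftMultiplication _ (ih hc)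
    obtain ⟨y, hy, rfl⟩ := exists_eq_leftMultiplication _ (ih hd)
    change ⁅leftMultiplication F x, leftMultiplication F y⁆ ∈ _
    rw [← leftMultiplication_mul]
    exact leftMultiplication_mem _ (mul_mem_prod hx hy)

variable [CharZero F] [FiniteDimensional F A]

/-- If `I` is a solvable ideal of a Leibniz algebra `A`, then `A I + I A` is nilpotent. -/
theorem nilpotent_prod_top_sup {I : Submodule F A} (hI : IsIdeal I) (h : Solvable I) :
    Nilpotent (prod ⊤ I ⊔ prod I ⊤) := by
  obtain ⟨k, hk⟩ := h
  have hD : LieAlgebra.derivedSeriesOfIdeal F _ k (leftMultiplicationsOfIdeal hI) = ⊥ := by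
    refine le_bot_iff.mp fun c hc => ?_
    obtain ⟨x, hx, rfl⟩ := exists_eq_leftMultiplication _
      (derivedSeriesOfIdeal_leftMultiplicationsOfIdeal_le hI k hc)
    rw [hk, Submodule.mem_bot] at hx
    rw [LieSubmodule.mem_bot, hx]
    exact Subtype.ext (map_zero _)
  have hnil := LieModule.isNilpotent_top_lie _ hD A
  set J := ⁅(⊤ : LieIdeal F (leftMultiplications F A)), leftMultiplicationsOfIdeal hI⁆
  have hmem : ∀ x ∈ prod ⊤ I ⊔ prod I ⊤, leftMultiplication F x ∈ J := by
    let S : Submodule F A := J.toSubmodule.comap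
      (LinearMap.codRestrict (leftMultiplications F A).toSubmodule (LinearMap.mul F A)
        fun x => ⟨x, rfl⟩)
    suffices prod ⊤ I ⊔ prod I ⊤ ≤ S from fun x hx => this hx
    refine sup_le (prod_le.mpr fun a _ x hx => ?_) (prod_le.mpr fun x hx a _ => ?_)
    · change leftMultiplication F (a * x) ∈ J
      rw [leftMultiplication_mul]
      exact LieSubmodule.lie_mem_lie (LieSubmodule.mem_top _) (leftMultiplication_mem hI hx)
    -- The product of `A` is not assumed antisymmetric, but the bracket of left multiplications is.
    · change leftMultiplication F (x * a) ∈ J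
      rw [leftMultiplication_mul, ← lie_skew]
      exact neg_mem
        (LieSubmodule.lie_mem_lie (LieSubmodule.mem_top _) (leftMultiplication_mem hI hx))
  obtain ⟨n, hn⟩ := (LieModule.isNilpotent_iff F J A).mp hnil
  refine ⟨n, le_bot_iff.mp ?_⟩
  have hle : ∀ m, lowerCentralSeries (prod ⊤ I ⊔ prod I ⊤) m ≤
      (LieModule.lowerCentralSeries F J A m).toSubmodule := by
    intro m
    induction m with
    | zero => simp
    | succ m ih =>
      refine prod_le.mpr fun x hx y hy => ?_
      rw [LieSubmodule.mem_toSubmodule, LieModule.lowerCentralSeries_succ,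
        ← leftMultiplication_lie (F := F)]
      exact LieSubmodule.lie_mem_lie (x := (⟨_, hmem x hx⟩ : J)) (LieSubmodule.mem_top _) (ih hy)
  simpa [hn] using hle n

theorem prod_top_sup_le_nilrad {I : Submodule F A} (hI : IsIdeal I) (h : Solvable I) :
    prod ⊤ I ⊔ prod I ⊤ ≤ nilrad F A :=
  le_sSup ⟨isIdeal_prod_top_sup hI, nilpotent_prod_top_sup hI h⟩

end LeftMultiplications

/-! ### The nilradical of the radical -/

section NilradicalOfRadical

variable {F A : Type*} [Field F] [NonUnitalNonAssocRing A] [Module F A]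
  [IsScalarTower F A A] [SMulCommClass F A A]

instance isLeftLeibniz_subalgebra [IsLeftLeibniz A] (S : NonUnitalSubalgebra F A) :
    IsLeftLeibniz S :=
  ⟨fun x y z => Subtype.ext (IsLeftLeibniz.leibniz (x : A) y z)⟩

variable [IsLeftLeibniz A] [CharZero F] [FiniteDimensional F A]

variable (F A) in
theorem map_nilrad_radSubalgebra :
    (nilrad F (radSubalgebra F A)).map
        (NonUnitalSubalgebraClass.subtype (radSubalgebra F A) : radSubalgebra F A →ₗ[F] A)
      = nilrad F A := by
  have hR := isGreatest_rad F A
  have hN := isGreatest_nilrad F A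
  have : FiniteDimensional F (radSubalgebra F A) :=
    inferInstanceAs (FiniteDimensional F (rad F A))
  have hNR := isGreatest_nilrad F (radSubalgebra F A)
  set f : radSubalgebra F A →ₗ[F] A :=
    (NonUnitalSubalgebraClass.subtype (radSubalgebra F A) : radSubalgebra F A →ₗ[F] A)
  have hmul : ∀ x y, f (x * y) = f x * f y := fun _ _ => rfl
  have hinj : Function.Injective f := Subtype.val_injective
  have hNle : nilrad F A ≤ rad F A :=
    hR.2 ⟨hN.1.1, hN.1.1.solvable_of_nilpotent hN.1.2⟩
  have hmap : ((nilrad F A).comap f).map f = nilrad F A := by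
    refine Submodule.map_comap_eq_of_le fun x hx => ?_
    exact ⟨⟨x, hNle hx⟩, rfl⟩
  have hge : nilrad F A ≤ (nilrad F (radSubalgebra F A)).map f := by
    rw [← hmap]
    refine Submodule.map_mono (hNR.2 ⟨fun a x hx => hN.1.1 (f a) (f x) hx, ?_⟩)
    rw [← nilpotent_map_iff hmul hinj, hmap]
    exact hN.1.2
  refine le_antisymm (hN.2 ⟨?_, (nilpotent_map_iff hmul hinj _).mpr hNR.1.2⟩) hge
  rintro a _ ⟨x, -, rfl⟩
  have hx : f x ∈ rad F A := x.2
  -- Elements of `nilrad(R)` lie in `R`, so their products with `A` fall in `AR + RA ⊆ N ⊆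
  -- nilrad(R)`.
  have hle := (prod_top_sup_le_nilrad hR.1.1 hR.1.2).trans hge
  exact ⟨hle (Submodule.mem_sup_left (mul_mem_prod Submodule.mem_top hx)),
    hle (Submodule.mem_sup_right (mul_mem_prod hx Submodule.mem_top))⟩

end NilradicalOfRadical

end LeibnizAlg

theorem mainTheorem9 (F : Type*) [Field F] [CharZero F]
    (A : Type*) [NonUnitalNonAssocRing A] [Module F A] [IsScalarTower F A A] [SMulCommClass F A A]
    [IsLeftLeibniz A] [FiniteDimensional F A] :
    -- `rad(A)` is the largest solvable ideal, `nilrad(A)` the largest nilpotent ideal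
    IsGreatest {I : Submodule F A | LeibnizAlg.IsIdeal I ∧ LeibnizAlg.Solvable I}
      (LeibnizAlg.rad F A) ∧
    IsGreatest {I : Submodule F A | LeibnizAlg.IsIdeal I ∧ LeibnizAlg.Nilpotent I}
      (LeibnizAlg.nilrad F A) ∧
    -- `A R + R A ⊆ N`
    LeibnizAlg.prod ⊤ (LeibnizAlg.rad F A) ⊔ LeibnizAlg.prod (LeibnizAlg.rad F A) ⊤
      ≤ LeibnizAlg.nilrad F A ∧
    -- if `A` is solvable, then `A²` is nilpotent
    (LeibnizAlg.Solvable (⊤ : Submodule F A) →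
      LeibnizAlg.Nilpotent (LeibnizAlg.prod (⊤ : Submodule F A) ⊤)) ∧
    -- `nilrad(rad(A)) = nilrad(A)`, where `rad(A)` is regarded as an algebra in its own right
    (LeibnizAlg.nilrad F (LeibnizAlg.radSubalgebra F A)).map
        (NonUnitalSubalgebraClass.subtype (LeibnizAlg.radSubalgebra F A) :
          LeibnizAlg.radSubalgebra F A →ₗ[F] A)
      = LeibnizAlg.nilrad F A := by
  have hR := LeibnizAlg.isGreatest_rad F A
  refine ⟨hR, LeibnizAlg.isGreatest_nilrad F A,
    LeibnizAlg.prod_top_sup_le_nilrad hR.1.1 hR.1.2, fun h => ?_,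
    LeibnizAlg.map_nilrad_radSubalgebra F A⟩
  have := LeibnizAlg.nilpotent_prod_top_sup (I := (⊤ : Submodule F A))
    (fun _ _ _ => ⟨Submodule.mem_top, Submodule.mem_top⟩) h
  rwa [sup_idem] at this
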